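/- For integers $0 \le m \le n$, let $\mathrm{PF}(m,n)$ be the set of parking functions with $m$ cars and $n$ spots: lists of preferences $\pi=(\pi_1,\dots,\pi_m)\in\{1,\dots,n\}^m$ such that, when cars $1,\dots,m$ enter a one-way street with spots $1,\dots,n$ in this order and each car parks in the first free spot from its preferred spot on, all cars park. Let $\mathrm{slev}(\pi)$ be the number of cars $i$ with $\pi_i\in\{1,\dots,n-m+1\}$. Let $\mathcal F(m,n)$ be the set of rooted forests with $n-m+1$ labelled roots $01,\dots,0(n-m+1)$, which are the roots of the different trees, and with $m$ labelled non-root vertices $1,\dots,m$. For $F\in\mathcal F(m,n)$ let $\deg(0)$ be the total number of children of all the roots. Let $0<c<1$, and let $m_k\le n_k$ ($k\in\mathbb N$) be nonnegative integers with $n_k\to\infty$ and $m_k=cn_k+O(1)$, i.e. $\sup_k|m_k-cn_k|<\infty$ (for example $m_k=cn_k$ or $m_k=\lfloor cn_k\rfloor$). If $\pi$ is uniformly distributed on $\mathrm{PF}(m_k,n_k)$, then, as $k\to\infty$, $$\frac{\mathrm{slev}(\pi)-c(1-c)n_k}{\sqrt{c^2(1-c)n_k}}\ \overset{\mathrm d}{\longrightarrow}\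 \mathcal N(0,1).$$ Likewise, if $F$ is uniformly distributed on $\mathcal F(m_k,n_k)$, then, as $k\to\infty$, $$\frac{\deg(0)-c(1-c)n_k}{\sqrt{c^2(1-c)n_k}}\ \overset{\mathrm d}{\longrightarrow}\ \mathcal N(0,1).$$ -/

import Mathlib

open MeasureTheory ProbabilityTheory Filter

/-- `m` cars with preferences `π` enter one by one a one-way street with `n` spots
(spot `k ∈ {1, …, n}` is the element of `Fin n` of value `k - 1`). The preference list is a
parking function if all cars park: there is an assignment `σ` of spots to cars such that each
car `i` takes the first spot from `π i` on that no earlier car has taken. -/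
def IsParkingFunction {m n : ℕ} (π : Fin m → Fin n) : Prop :=
  ∃ σ : Fin m → Fin n, ∀ i : Fin m, IsLeast {q : Fin n | π i ≤ q ∧ ∀ j < i, σ j ≠ q} (σ i)

/-- The set `PF(m, n)` of parking functions with `m` cars and `n` spots. -/
def PF (m n : ℕ) : Set (Fin m → Fin n) := {π | IsParkingFunction π}

/-- Size of level set: the number of cars whose preferred spot is one of `1, …, n - m + 1`
(the elements of `Fin n` of value less than `n - m + 1`). -/
def slev {m n : ℕ} (π : Fin m → Fin n) : ℕ :=
  (Finset.univ.filter fun i : Fin m => (π i : ℕ) < n - m + 1).card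

/-- The set `F(m, n)` of rooted forests with `n - m + 1` labelled roots `Sum.inl _` and `m`
labelled non-root vertices `Sum.inr _` (so `n + 1` vertices and `m` edges), each root being the
root of its own tree. A rooted forest is given by its parent function `f`, which sends every
non-root vertex to its parent (a root or a non-root vertex), and which is acyclic: no vertex is
a proper ancestor of itself. -/
def RootedForests (m n : ℕ) : Set (Fin m → Fin (n - m + 1) ⊕ Fin m) :=
  {f | ∀ i : Fin m, ¬ Relation.TransGen (fun a b : Fin m => f a = Sum.inr b) i i}

/-- The number of children of the vertex `v` in the forest with parent function `f`. -/
def childCount {r m : ℕ} (f : Fin m → Fin r ⊕ Fin m) (v : Fin r ⊕ Fin m) : ℕ :=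
  (Finset.univ.filter fun i : Fin m => f i = v).card

/-- The root degree `deg(0)`: the total number of children of all roots. -/
def rootDeg {r m : ℕ} (f : Fin m → Fin r ⊕ Fin m) : ℕ :=
  ∑ j : Fin r, childCount f (Sum.inl j)

instance instDiscreteMeasurableSpaceVertex (r m : ℕ) :
    DiscreteMeasurableSpace (Fin r ⊕ Fin m) :=
  ⟨fun _ => measurableSet_sum_iff.2 ⟨MeasurableSet.of_discrete, MeasurableSet.of_discrete⟩⟩

theorem PF_nonempty {m n : ℕ} (h : m ≤ n) : (PF m n).Nonempty := by
  refine ⟨Fin.castLE h, Fin.castLE h, fun i => ⟨⟨le_rfl, fun j hj hji => ?_⟩, fun q hq => hq.1⟩⟩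
  exact hj.ne (Fin.castLE_injective h hji)

theorem RootedForests_nonempty (m n : ℕ) : (RootedForests m n).Nonempty := by
  refine ⟨fun _ => Sum.inl 0, fun i hi => ?_⟩
  obtain ⟨b, hb, -⟩ := Relation.TransGen.head'_iff.1 hi
  cases hb

theorem isProbabilityMeasure_uniformOn_PF {m n : ℕ} (h : m ≤ n) :
    IsProbabilityMeasure (uniformOn (PF m n)) :=
  isProbabilityMeasure_uniformOn' (Set.toFinite _) (PF_nonempty h) (Set.toFinite _).measurableSet

instance isProbabilityMeasure_uniformOn_RootedForests (m n : ℕ) :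
    IsProbabilityMeasure (uniformOn (RootedForests m n)) :=
  isProbabilityMeasure_uniformOn' (Set.toFinite _) (RootedForests_nonempty m n)
    (MeasurableSet.of_discrete)

/-! Put r = n - m + 1. For m ≥ 1 both statistics have the same generating function, r z (r z +
m)^(m-1). Divided by its value at z = 1 it becomes z ((r z + m)/(r + m))^(m-1), so each statistic is
distributed as 1 + Bin(m - 1, p) with p = r/(r + m) = (n - m + 1)/(n + 1). Since p → 1 - c, the
variance is asymptotic to c²(1 - c)n, and the mean is c(1 - c)n + O(1); the rest is a binomial
central limit theorem with varying p.

The generating function comes from fixing the set A of children of the roots, respectively of cars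
counted by `slev`. The elements of A have r free choices each. What remains is a structure of the
same kind on the complement of A, with |A| in the role of r: a forest whose roots are A, or a
parking function with |A| - 1 spots more than cars. Thus both families satisfy one recursion, solved
by `forestCount` through the binomial theorem (`sum_choose_mul_forestCount`). Setting z = 1 carries
the induction (`card_of_fiber`); general z gives the distribution (`sum_pow_card_of_fiber`). -/

/-! ### The common recursion and its solution -/

/-- The number of rooted forests with `r` labelled roots and `m` labelled non-root vertices. -/
def forestCount (m r : ℕ) : ℕ := if m = 0 then 1 else r * (r + m) ^ (m - 1)

/-- The factor k + 1 in `forestCount` is absorbed by (k + 1) C(m + 1, k + 1) = (m + 1) C(m, k). The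
case k = m is where the convention `forestCount 0 r = 1` enters. -/
theorem choose_mul_forestCount {m k : ℕ} (hk : k ≤ m) :
    (m + 1).choose (k + 1) * forestCount (m - k) (k + 1) = m.choose k * (m + 1) ^ (m - k) := by
  rcases hk.eq_or_lt with rfl | hk
  · simp [forestCount]
  · obtain ⟨j, rfl⟩ := Nat.exists_eq_add_of_lt hk
    have h := Nat.add_one_mul_choose_eq (k + j + 1) k
    have h1 : k + j + 1 - k = j + 1 := by omega
    rw [h1, forestCount, if_neg (by omega), Nat.add_sub_cancel, pow_succ,
      show k + 1 + (j + 1) = k + j + 1 + 1 by ring, ← mul_assoc, ← h]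
    ring

/-- The term k = 0 vanishes, and after absorption the others are x times the binomial expansion of
(x + (m + 1))^m. -/
theorem sum_choose_mul_forestCount {R : Type*} [CommSemiring R] (m : ℕ) (x : R) :
    ∑ k ∈ Finset.range (m + 2), (m + 1).choose k • (x ^ k * (forestCount (m + 1 - k) k : R)) =
      x * (x + (m + 1)) ^ m := by
  rw [Finset.sum_range_succ', add_pow, Finset.mul_sum]
  have h0 : forestCount (m + 1) 0 = 0 := by simp [forestCount]
  simp only [Nat.sub_zero, h0, Nat.cast_zero, mul_zero, smul_zero, add_zero]
  refine Finset.sum_congr rfl fun k hk => ?_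
  have h := congrArg (Nat.cast : ℕ → R)
    (choose_mul_forestCount (Nat.lt_succ_iff.1 (Finset.mem_range.1 hk)))
  push_cast at h
  rw [show m + 1 - (k + 1) = m - k by omega, nsmul_eq_mul, mul_left_comm, h]
  ring

open Classical in
/-- Summing over the level sets of a set-valued statistic whose level sets are counted by
`forestCount`. -/
theorem sum_pow_card_of_fiber {R α Φ : Type*} [CommSemiring R] [Fintype α] [Fintype Φ]
    {P : Φ → Prop} {S : Φ → Finset α} {m r : ℕ} (hα : Fintype.card α = m + 1)
    (h : ∀ A, Nat.card {f // P f ∧ S f = A} = r ^ A.card * forestCount (m + 1 - A.card) A.card)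
    (z : R) :
    ∑ f with P f, z ^ (S f).card = r * z * (r * z + (m + 1)) ^ m := by
  rw [← sum_choose_mul_forestCount, ← Finset.sum_fiberwise (Finset.univ.filter P) S]
  have hA : ∀ A : Finset α, ∑ f ∈ Finset.univ.filter P with S f = A, z ^ (S f).card =
      (r * z) ^ A.card * (forestCount (m + 1 - A.card) A.card : R) := by
    intro A
    rw [Finset.sum_congr rfl (g := fun _ => z ^ A.card)
      (fun f hf => by rw [(Finset.mem_filter.1 hf).2]), Finset.sum_const, Finset.filter_filter,
      ← Fintype.card_subtype, ← Nat.card_eq_fintype_card, h, nsmul_eq_mul]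
    push_cast
    ring
  simp_rw [hA]
  rw [← Finset.powerset_univ, Finset.sum_powerset_apply_card
    (fun k => (r * z) ^ k * (forestCount (m + 1 - k) k : R)), Finset.card_univ, hα]

/-- The case z = 1: it turns the fibre counts, known from smaller structures, into the total count,
and so is the inductive step for both families. -/
theorem card_of_fiber {α Φ : Type*} [Fintype α] [Fintype Φ]
    {P : Φ → Prop} {S : Φ → Finset α} {m r : ℕ} (hα : Fintype.card α = m + 1)
    (h : ∀ A, Nat.card {f // P f ∧ S f = A} = r ^ A.card * forestCount (m + 1 - A.card) A.card) :
    Nat.card {f // P f} = forestCount (m + 1) r := by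
  classical
  have := sum_pow_card_of_fiber hα h (1 : ℕ)
  simp only [one_pow, Finset.sum_const, smul_eq_mul, mul_one, Nat.cast_id] at this
  rw [Nat.card_eq_fintype_card, Fintype.card_subtype, this]
  simp [forestCount]

/-! ### Forests -/

/-- The parent function `f` has no infinite ascending chain of ancestors. -/
def IsForest {α β : Type*} (f : α → β ⊕ α) : Prop :=
  WellFounded fun b a => f a = Sum.inr b

/-- On a finite type an irreflexive transitive relation is well founded. Well-foundedness is the
form that permits induction from the roots downwards. -/
theorem isForest_iff {α β : Type*} [Finite α] (f : α → β ⊕ α) :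
    IsForest f ↔ ∀ i, ¬ Relation.TransGen (fun a b => f a = Sum.inr b) i i := by
  have key : ∀ i, Relation.TransGen (fun a b => f a = Sum.inr b) i i ↔
      Relation.TransGen (fun b a => f a = Sum.inr b) i i := fun i =>
    Relation.transGen_swap (r := fun b a => f a = Sum.inr b)
  simp_rw [key]
  refine ⟨fun h i hi => ?_, fun h => ?_⟩
  · exact (WellFounded.transGen h).irrefl.irrefl i hi
  · have : Std.Irrefl (Relation.TransGen fun b a => f a = Sum.inr b) := ⟨h⟩
    exact Subrelation.wf (r := Relation.TransGen fun b a => f a = Sum.inr b)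
      (fun h => Relation.TransGen.single h) (Finite.wellFounded_of_trans_of_irrefl _)

section

open scoped Classical

/-- The set of children of the roots. -/
noncomputable def rootChildren {α β : Type*} [Fintype α] (f : α → β ⊕ α) : Finset α :=
  Finset.univ.filter fun a => (f a).isLeft

theorem mem_rootChildren {α β : Type*} [Fintype α] {f : α → β ⊕ α} {a : α} :
    a ∈ rootChildren f ↔ (f a).isLeft := by simp [rootChildren]

/-- The parent function in which `A` is the set of children of the roots and the other vertices
hang from `A`. -/
noncomputable def graft {α β : Type*} (A : Finset α)
    (x : ({a // a ∈ A} → β) × ({a // a ∉ A} → {a // a ∈ A} ⊕ {a // a ∉ A})) (a : α) : β ⊕ α :=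
  if ha : a ∈ A then Sum.inl (x.1 ⟨a, ha⟩) else Sum.inr (Equiv.sumCompl (· ∈ A) (x.2 ⟨a, ha⟩))

theorem graft_of_mem {α β : Type*} {A : Finset α} {a : α} (ha : a ∈ A)
    (x : ({a // a ∈ A} → β) × ({a // a ∉ A} → {a // a ∈ A} ⊕ {a // a ∉ A})) :
    graft A x a = Sum.inl (x.1 ⟨a, ha⟩) := by simp [graft, ha]

theorem graft_of_notMem {α β : Type*} {A : Finset α} {a : α} (ha : a ∉ A)
    (x : ({a // a ∈ A} → β) × ({a // a ∉ A} → {a // a ∈ A} ⊕ {a // a ∉ A})) :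
    graft A x a = Sum.inr (Equiv.sumCompl (· ∈ A) (x.2 ⟨a, ha⟩)) := by simp [graft, ha]

theorem rootChildren_graft {α β : Type*} [Fintype α] (A : Finset α)
    (x : ({a // a ∈ A} → β) × ({a // a ∉ A} → {a // a ∈ A} ⊕ {a // a ∉ A})) :
    rootChildren (graft A x) = A := by
  ext a
  by_cases ha : a ∈ A <;> simp [mem_rootChildren, graft, ha]

/-- A chain of ancestors that reaches A stops there, because the parent of a vertex of A is a root.
Only chains outside A can be infinite, and these are chains of `x.2`. -/
theorem isForest_graft {α β : Type*} (A : Finset α)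
    (x : ({a // a ∈ A} → β) × ({a // a ∉ A} → {a // a ∈ A} ⊕ {a // a ∉ A})) :
    IsForest (graft A x) ↔ IsForest x.2 := by
  constructor
  · intro h
    refine Subrelation.wf (r := InvImage (fun b a => graft A x a = Sum.inr b) Subtype.val)
      (fun {b a} hba => ?_) (InvImage.wf _ h)
    simp only [InvImage, graft_of_notMem a.2, hba]
    simp
  · intro h
    have hA : ∀ a ∈ A, Acc (fun b a => graft A x a = Sum.inr b) a := fun a ha =>
      Acc.intro a fun b hb => by simp [graft_of_mem ha] at hb
    have hc : ∀ a : {a // a ∉ A}, Acc (fun b a => graft A x a = Sum.inr b) a.1 := by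
      intro a
      induction a using h.induction with
      | _ a ih =>
        refine Acc.intro _ fun b hb => ?_
        rw [graft_of_notMem a.2, Sum.inr.injEq] at hb
        rcases hx : x.2 a with c | c
        · rw [hx] at hb
          exact hA b (by rw [← hb]; simp)
        · rw [hx] at hb
          have : b = c := by rw [← hb]; simp
          exact this ▸ ih c hx
    exact ⟨fun a => if ha : a ∈ A then hA a ha else hc ⟨a, ha⟩⟩

theorem graft_injective {α β : Type*} (A : Finset α) :
    Function.Injective (graft (β := β) A) := by
  intro x y hxy
  refine Prod.ext (funext fun a => ?_) (funext fun a => ?_)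
  · have := congrFun hxy a.1
    simpa [graft_of_mem a.2] using this
  · have := congrFun hxy a.1
    rw [graft_of_notMem a.2, graft_of_notMem a.2, Sum.inr.injEq] at this
    exact (Equiv.sumCompl (· ∈ A)).injective this

theorem exists_graft_eq {α β : Type*} [Fintype α] (f : α → β ⊕ α) :
    ∃ x, graft (rootChildren f) x = f := by
  classical
  have h1 : ∀ a : {a // a ∈ rootChildren f}, ∃ b, f a = Sum.inl b := fun a =>
    Sum.isLeft_iff.1 (mem_rootChildren.1 a.2)
  have h2 : ∀ a : {a // a ∉ rootChildren f}, ∃ b, f a = Sum.inr b := fun a =>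
    Sum.isRight_iff.1 (by simpa using mem_rootChildren.not.1 a.2)
  choose h hh using h1
  choose g hg using h2
  refine ⟨(h, fun a => (Equiv.sumCompl (· ∈ rootChildren f)).symm (g a)), funext fun a => ?_⟩
  by_cases ha : a ∈ rootChildren f
  · rw [graft_of_mem ha, hh ⟨a, ha⟩]
  · rw [graft_of_notMem ha, Equiv.apply_symm_apply, hg ⟨a, ha⟩]

/-- Deleting the roots promotes A to the root set of the remaining forest; `graft` is the inverse
operation. -/
theorem card_isForest_fiber {α β : Type*} [Fintype α] [Fintype β] (A : Finset α) :
    Nat.card {f : α → β ⊕ α // IsForest f ∧ rootChildren f = A} =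
      Fintype.card β ^ A.card *
        Nat.card {g : {a // a ∉ A} → {a // a ∈ A} ⊕ {a // a ∉ A} // IsForest g} := by
  have e : ({a // a ∈ A} → β) × {g : {a // a ∉ A} → {a // a ∈ A} ⊕ {a // a ∉ A} // IsForest g} ≃
      {f : α → β ⊕ α // IsForest f ∧ rootChildren f = A} := by
    refine Equiv.ofBijective (fun x => ⟨graft A (x.1, x.2.1),
      (isForest_graft A _).2 x.2.2, rootChildren_graft A _⟩) ⟨fun x y hxy => ?_, fun f => ?_⟩
    · have : (x.1, x.2.1) = (y.1, y.2.1) := graft_injective A (congrArg Subtype.val hxy)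
      exact Prod.ext (Prod.ext_iff.1 this).1 (Subtype.ext (Prod.ext_iff.1 this).2)
    · obtain ⟨f, hf, rfl⟩ := f
      obtain ⟨x, hx⟩ := exists_graft_eq f
      exact ⟨(x.1, ⟨x.2, (isForest_graft _ x).1 (by rwa [hx])⟩), Subtype.ext hx⟩
  rw [← Nat.card_congr e, Nat.card_prod, Nat.card_fun]
  simp

theorem not_isForest_of_isEmpty {α β : Type*} [Nonempty α] [IsEmpty β] (f : α → β ⊕ α) :
    ¬ IsForest f := fun h => by
  obtain ⟨a, -, ha⟩ := h.has_min Set.univ Set.univ_nonempty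
  rcases hf : f a with b | b
  · exact isEmptyElim b
  · exact ha b trivial hf

theorem card_isForest_fiber_eq_forestCount {m r : ℕ}
    (ih : ∀ j ≤ m, ∀ (α β : Type) [Fintype α] [Fintype β], Fintype.card α = j →
      Nat.card {f : α → β ⊕ α // IsForest f} = forestCount j (Fintype.card β))
    {α β : Type} [Fintype α] [Fintype β] (hα : Fintype.card α = m + 1) (hβ : Fintype.card β = r)
    (A : Finset α) :
    Nat.card {f : α → β ⊕ α // IsForest f ∧ rootChildren f = A} =
      r ^ A.card * forestCount (m + 1 - A.card) A.card := by
  rw [card_isForest_fiber, hβ]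
  congr 1
  have hc : Fintype.card {a // a ∉ A} = m + 1 - A.card := by
    rw [Fintype.card_subtype_compl, hα, Fintype.card_coe]
  -- If A is empty, the complement is not smaller and `ih` does not apply; but then both sides are
  -- 0, as a nonempty forest needs a root.
  rcases A.eq_empty_or_nonempty with rfl | hA
  · have : Nonempty {a : α // a ∉ (∅ : Finset α)} := Fintype.card_pos_iff.1 (by rw [hc]; simp)
    have : IsEmpty {g : {a : α // a ∉ (∅ : Finset α)} →
        {a : α // a ∈ (∅ : Finset α)} ⊕ {a : α // a ∉ (∅ : Finset α)} // IsForest g} :=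
      ⟨fun g => not_isForest_of_isEmpty g.1 g.2⟩
    simp [forestCount]
  · have := hA.card_pos
    rw [ih (m + 1 - A.card) (by omega) _ _ hc, Fintype.card_coe]

theorem card_isForest (m : ℕ) : ∀ (α β : Type) [Fintype α] [Fintype β], Fintype.card α = m →
    Nat.card {f : α → β ⊕ α // IsForest f} = forestCount m (Fintype.card β) := by
  induction m using Nat.strong_induction_on with
  | _ m ih =>
    intro α β _ _ hα
    rcases m with _ | m
    · have : IsEmpty α := Fintype.card_eq_zero_iff.1 hα
      have : Unique {f : α → β ⊕ α // IsForest f} :=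
        ⟨⟨⟨isEmptyElim, ⟨fun a => isEmptyElim a⟩⟩⟩, fun f => Subtype.ext (Subsingleton.elim _ _)⟩
      simp [forestCount]
    · exact card_of_fiber hα (card_isForest_fiber_eq_forestCount
        (fun j hj => ih j (Nat.lt_succ_of_le hj)) hα rfl)

theorem sum_pow_card_rootChildren {R α β : Type} [CommSemiring R] [Fintype α] [Fintype β]
    {m : ℕ} (hα : Fintype.card α = m + 1) (z : R) :
    ∑ f : α → β ⊕ α with IsForest f, z ^ (rootChildren f).card =
      Fintype.card β * z * (Fintype.card β * z + (m + 1)) ^ m :=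
  sum_pow_card_of_fiber hα
    (card_isForest_fiber_eq_forestCount (fun j _ => card_isForest j) hα rfl) z

theorem rootDeg_eq_card_rootChildren {r m : ℕ} (f : Fin m → Fin r ⊕ Fin m) :
    rootDeg f = (rootChildren f).card := by
  rw [rootDeg, Finset.card_eq_sum_ones, rootChildren, Finset.sum_filter]
  simp_rw [childCount, Finset.card_filter]
  rw [Finset.sum_comm]
  refine Finset.sum_congr rfl fun i _ => ?_
  rcases f i with b | b <;> simp

theorem sum_pow_rootDeg {R : Type} [CommSemiring R] {m n : ℕ} (hm : m ≠ 0) (z : R) :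
    ∑ f ∈ (RootedForests m n).toFinite.toFinset, z ^ rootDeg f =
      (n - m + 1 : ℕ) * z * ((n - m + 1 : ℕ) * z + m) ^ (m - 1) := by
  obtain ⟨m, rfl⟩ := Nat.exists_eq_add_one_of_ne_zero hm
  rw [Nat.add_sub_cancel, Nat.cast_add_one m]
  have := sum_pow_card_rootChildren (β := Fin (n - (m + 1) + 1)) (Fintype.card_fin (m + 1)) z
  rw [Fintype.card_fin] at this
  rw [← this]
  refine Finset.sum_congr ?_ fun f _ => by rw [rootDeg_eq_card_rootChildren]
  ext f
  simp [RootedForests, isForest_iff]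

end

/-! ### Parking functions -/

/-- Cars never move back, so those preferring a spot from v on occupy distinct spots of [v, n). -/
theorem IsParkingFunction.card_le {m n : ℕ} {π : Fin m → Fin n} (h : IsParkingFunction π) (v : ℕ) :
    (Finset.univ.filter fun i => v ≤ (π i : ℕ)).card ≤ n - v := by
  obtain ⟨σ, hσ⟩ := h
  have hinj : Function.Injective σ := by
    intro i j hij
    rcases lt_trichotomy i j with h | h | h
    · exact absurd hij ((hσ j).1.2 i h)
    · exact h
    · exact absurd hij.symm ((hσ i).1.2 j h)
  calc _ ≤ (Finset.Ico v n).card := by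
        refine Finset.card_le_card_of_injOn (fun i => (σ i : ℕ)) (fun i hi => ?_)
          (fun i _ j _ hij => hinj (Fin.ext hij))
        have h1 : v ≤ (π i : ℕ) := by simpa using hi
        have h2 : (π i : ℕ) ≤ σ i := (hσ i).1.1
        simp only [Finset.coe_Ico, Set.mem_Ico]
        exact ⟨h1.trans h2, (σ i).2⟩
    _ = n - v := by simp

/-- A car finds a free spot if the counting condition holds. -/
theorem exists_free_spot {m n : ℕ} {π : Fin m → Fin n}
    (h : ∀ v ≤ n, (Finset.univ.filter fun i => v ≤ (π i : ℕ)).card ≤ n - v) {σ : Fin m → Fin n}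
    {k : Fin m} (hσ : ∀ i < k, IsLeast {q : Fin n | π i ≤ q ∧ ∀ j < i, σ j ≠ q} (σ i)) :
    {q : Fin n | π k ≤ q ∧ ∀ j < k, σ j ≠ q}.Nonempty := by
  classical
  by_contra hne
  have hfull : ∀ q : Fin n, (π k : ℕ) ≤ q → ∃ j < k, σ j = q := by
    intro q hq
    by_contra hcon
    push Not at hcon
    exact hne ⟨q, hq, hcon⟩
  have hex : ∃ v : ℕ, ∀ q : Fin n, v ≤ (q : ℕ) → ∃ j < k, σ j = q := ⟨_, hfull⟩
  -- The block of occupied spots at the end of the street is extended to the left as far as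
  -- possible, down to v.
  set v := Nat.find hex with hv
  have hvs : ∀ q : Fin n, v ≤ (q : ℕ) → ∃ j < k, σ j = q := Nat.find_spec hex
  have hvk : v ≤ π k := Nat.find_min' hex hfull
  have hvn : v < n := hvk.trans_lt (π k).2
  -- By minimality of v, spot v - 1 is still free, so a car preferring a spot before v would have
  -- parked no later than there.
  have hpref : ∀ j < k, v ≤ (σ j : ℕ) → v ≤ (π j : ℕ) := by
    intro j hj hjv
    by_contra! hlt
    have hmin := Nat.find_min hex (m := v - 1) (by omega)
    push Not at hmin
    obtain ⟨q, hq1, hq2⟩ := hmin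
    have hqv : (q : ℕ) < v := by
      by_contra! hc
      obtain ⟨i, hi, hiq⟩ := hvs q hc
      exact hq2 i hi hiq
    have hle : σ j ≤ q := (hσ j hj).2 ⟨by rw [Fin.le_def]; omega, fun i hi => hq2 i (hi.trans hj)⟩
    rw [Fin.le_def] at hle
    omega
  have : Nonempty (Fin m) := ⟨k⟩
  choose! c hc hcq using fun q : Fin n => hvs q
  -- The n - v cars parked from v on, together with car k, are n - v + 1 cars preferring spots from
  -- v on: one too many.
  have hcard : (insert k ((Finset.univ.filter fun q : Fin n => v ≤ (q : ℕ)).image c)).card ≤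
      (Finset.univ.filter fun i => v ≤ (π i : ℕ)).card := by
    refine Finset.card_le_card fun i hi => ?_
    simp only [Finset.mem_insert, Finset.mem_image, Finset.mem_filter, Finset.mem_univ,
      true_and] at hi ⊢
    rcases hi with rfl | ⟨q, hq, rfl⟩
    · exact hvk
    · exact hpref _ (hc q hq) (by rwa [hcq q hq])
  rw [Finset.card_insert_of_notMem, Finset.card_image_of_injOn] at hcard
  · have h1 := hcard.trans (h v hvn.le)
    have h2 : (Finset.univ.filter fun q : Fin n => v ≤ (q : ℕ)).card = n - v := by
      rw [← Fin.card_Ici (⟨v, hvn⟩ : Fin n)]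
      congr 1
      ext q
      simp [Fin.le_def]
    omega
  · intro q hq q' hq' hqq
    simp only [Finset.coe_filter, Finset.mem_univ, true_and, Set.mem_ofPred_eq] at hq hq'
    rw [← hcq q hq, ← hcq q' hq', hqq]
  · intro hk
    simp only [Finset.mem_image, Finset.mem_filter, Finset.mem_univ, true_and] at hk
    obtain ⟨q, hq, hqk⟩ := hk
    exact (hc q hq).ne hqk

theorem isParkingFunction_iff {m n : ℕ} (π : Fin m → Fin n) :
    IsParkingFunction π ↔
      ∀ v ≤ n, (Finset.univ.filter fun i => v ≤ (π i : ℕ)).card ≤ n - v := by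
  refine ⟨fun h v _ => h.card_le v, fun h => ?_⟩
  -- The cars are parked one at a time. Values of σ at later cars are irrelevant, so π serves as the
  -- initial σ.
  have key : ∀ k ≤ m, ∃ σ : Fin m → Fin n, ∀ i : Fin m, (i : ℕ) < k →
      IsLeast {q : Fin n | π i ≤ q ∧ ∀ j < i, σ j ≠ q} (σ i) := by
    intro k
    induction k with
    | zero => exact fun _ => ⟨π, fun i hi => absurd hi (Nat.not_lt_zero _)⟩
    | succ k ih =>
      intro hk
      obtain ⟨σ, hσ⟩ := ih (by omega)
      obtain ⟨q, hq⟩ : ∃ q, IsLeast {q : Fin n | π ⟨k, hk⟩ ≤ q ∧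
          ∀ j < (⟨k, hk⟩ : Fin m), σ j ≠ q} q :=
        Set.exists_min_image _ id (Set.toFinite _)
          (exists_free_spot (k := ⟨k, hk⟩) h fun i hi => hσ i hi)
      refine ⟨Function.update σ ⟨k, hk⟩ q, fun i hi => ?_⟩
      have hset : ∀ j < i, Function.update σ ⟨k, hk⟩ q j = σ j := fun j hj =>
        Function.update_of_ne (fun hjk => by
          have : (j : ℕ) < i := hj
          rw [hjk] at this
          simp only at this
          omega) _ _
      have hset' : {p : Fin n | π i ≤ p ∧ ∀ j < i, Function.update σ ⟨k, hk⟩ q j ≠ p} =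
          {p : Fin n | π i ≤ p ∧ ∀ j < i, σ j ≠ p} := by
        ext p
        exact and_congr_right fun _ => forall₂_congr fun j hj => by rw [hset j hj]
      rw [hset']
      rcases (Nat.lt_succ_iff.1 hi).eq_or_lt with hik | hik
      · obtain rfl : i = ⟨k, hk⟩ := Fin.ext hik
        rwa [Function.update_self]
      · rw [Function.update_of_ne (fun h => by rw [h] at hik; exact lt_irrefl _ hik)]
        exact hσ i hik
  obtain ⟨σ, hσ⟩ := key m le_rfl
  exact ⟨σ, fun i => hσ i i.2⟩

/-! ### Parking functions read from the end of the street, and their fibres -/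

section

open scoped Classical

/-- The classical counting condition for parking functions, for preferences read from the end of
the street. -/
def IsParkingCount {α : Type*} [Fintype α] {n : ℕ} (p : α → Fin n) : Prop :=
  ∀ v, (Finset.univ.filter fun i => (p i : ℕ) < v).card ≤ v

/-- The cars whose preference has value at least `m`. -/
noncomputable def highCars {α : Type*} [Fintype α] {n : ℕ} (m : ℕ) (p : α → Fin n) : Finset α :=
  Finset.univ.filter fun i => m ≤ (p i : ℕ)

/-- Preferences `m + x.1` on `A` and `x.2` off `A`. -/
noncomputable def gluePrefs {α : Type*} {m r : ℕ} (A : Finset α)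
    (x : ({a // a ∈ A} → Fin r) × ({a // a ∉ A} → Fin m)) (a : α) : Fin (m + r) :=
  if ha : a ∈ A then Fin.natAdd m (x.1 ⟨a, ha⟩) else Fin.castAdd r (x.2 ⟨a, ha⟩)

theorem gluePrefs_of_mem {α : Type*} {m r : ℕ} {A : Finset α} {a : α} (ha : a ∈ A)
    (x : ({a // a ∈ A} → Fin r) × ({a // a ∉ A} → Fin m)) :
    gluePrefs A x a = Fin.natAdd m (x.1 ⟨a, ha⟩) := by simp [gluePrefs, ha]

theorem gluePrefs_of_notMem {α : Type*} {m r : ℕ} {A : Finset α} {a : α} (ha : a ∉ A)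
    (x : ({a // a ∈ A} → Fin r) × ({a // a ∉ A} → Fin m)) :
    gluePrefs A x a = Fin.castAdd r (x.2 ⟨a, ha⟩) := by simp [gluePrefs, ha]

theorem mem_highCars {α : Type*} [Fintype α] {n m : ℕ} {p : α → Fin n} {a : α} :
    a ∈ highCars m p ↔ m ≤ (p a : ℕ) := by simp [highCars]

theorem highCars_gluePrefs {α : Type*} [Fintype α] {m r : ℕ} (A : Finset α)
    (x : ({a // a ∈ A} → Fin r) × ({a // a ∉ A} → Fin m)) :
    highCars m (gluePrefs A x) = A := by
  ext a
  by_cases ha : a ∈ A <;> simp [mem_highCars, gluePrefs, ha]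

theorem card_gluePrefs_lt {α : Type*} [Fintype α] {m r v : ℕ} (hv : v ≤ m) (A : Finset α)
    (x : ({a // a ∈ A} → Fin r) × ({a // a ∉ A} → Fin m)) :
    (Finset.univ.filter fun i => (gluePrefs A x i : ℕ) < v).card =
      (Finset.univ.filter fun i => (x.2 i : ℕ) < v).card := by
  rw [← Finset.card_map (Function.Embedding.subtype (· ∉ A))]
  congr 1
  ext a
  by_cases ha : a ∈ A
  · simp [gluePrefs_of_mem ha, ha]; omega
  · simp [gluePrefs_of_notMem ha, ha]

/-- The condition for v ≤ m sees only cars off A. For v > m it holds automatically on the left since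
there are only m + 1 cars, and on the right it follows from the case v = m. -/
theorem isParkingCount_gluePrefs {α : Type*} [Fintype α] {m r : ℕ}
    (hα : Fintype.card α = m + 1) (A : Finset α)
    (x : ({a // a ∈ A} → Fin r) × ({a // a ∉ A} → Fin m)) :
    IsParkingCount (gluePrefs A x) ↔ IsParkingCount x.2 := by
  constructor
  · intro h v
    rcases le_total v m with hv | hv
    · rw [← card_gluePrefs_lt hv]
      exact h v
    · refine le_trans ?_ hv
      refine le_trans ?_ (h m)
      rw [card_gluePrefs_lt le_rfl]
      exact Finset.card_le_card fun i _ => by simp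
  · intro h v
    rcases le_or_gt v m with hv | hv
    · rw [card_gluePrefs_lt hv]
      exact h v
    · exact (Finset.card_le_univ _).trans (by omega)

theorem gluePrefs_injective {α : Type*} {m r : ℕ} (A : Finset α) :
    Function.Injective (gluePrefs (m := m) (r := r) A) := by
  intro x y hxy
  refine Prod.ext (funext fun a => ?_) (funext fun a => ?_)
  · have := congrFun hxy a.1
    simpa [gluePrefs_of_mem a.2] using this
  · have := congrFun hxy a.1
    rw [gluePrefs_of_notMem a.2, gluePrefs_of_notMem a.2] at this
    exact Fin.castAdd_injective _ _ this

theorem exists_gluePrefs_eq {α : Type*} [Fintype α] {m r : ℕ} (p : α → Fin (m + r)) :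
    ∃ x, gluePrefs (highCars m p) x = p := by
  refine ⟨(fun a => Fin.subNat m ((p a).cast (Nat.add_comm m r)) (by
    simpa using mem_highCars.1 a.2), fun a => ⟨p a, by simpa using mem_highCars.not.1 a.2⟩),
    funext fun a => ?_⟩
  by_cases ha : a ∈ highCars m p
  · rw [gluePrefs_of_mem ha]
    have := mem_highCars.1 ha
    ext
    simp
  · rw [gluePrefs_of_notMem ha]
    ext
    simp

/-- High preferences are unconstrained. The other m + 1 - |A| cars use m spots, so the number of
spots minus cars plus one is now |A|. -/
theorem card_isParkingCount_fiber {α : Type*} [Fintype α] {m : ℕ} (r : ℕ)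
    (hα : Fintype.card α = m + 1) (A : Finset α) :
    Nat.card {p : α → Fin (m + r) // IsParkingCount p ∧ highCars m p = A} =
      r ^ A.card * Nat.card {q : {a // a ∉ A} → Fin m // IsParkingCount q} := by
  have e : ({a // a ∈ A} → Fin r) × {q : {a // a ∉ A} → Fin m // IsParkingCount q} ≃
      {p : α → Fin (m + r) // IsParkingCount p ∧ highCars m p = A} := by
    refine Equiv.ofBijective (fun x => ⟨gluePrefs A (x.1, x.2.1),
      (isParkingCount_gluePrefs hα A _).2 x.2.2, highCars_gluePrefs A _⟩)
      ⟨fun x y hxy => ?_, fun p => ?_⟩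
    · have : (x.1, x.2.1) = (y.1, y.2.1) := gluePrefs_injective A (congrArg Subtype.val hxy)
      exact Prod.ext (Prod.ext_iff.1 this).1 (Subtype.ext (Prod.ext_iff.1 this).2)
    · obtain ⟨p, hp, rfl⟩ := p
      obtain ⟨x, hx⟩ := exists_gluePrefs_eq p
      exact ⟨(x.1, ⟨x.2, (isParkingCount_gluePrefs hα _ x).1 (by rwa [hx])⟩), Subtype.ext hx⟩
  rw [← Nat.card_congr e, Nat.card_prod, Nat.card_fun]
  simp

theorem IsParkingCount.card_le {α : Type*} [Fintype α] {n : ℕ} {p : α → Fin n}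
    (h : IsParkingCount p) : Fintype.card α ≤ n := by
  simpa using h n

theorem card_isParkingCount_fiber_eq_forestCount {m r : ℕ}
    (ih : ∀ j ≤ m, ∀ (α : Type) [Fintype α] (n k : ℕ), Fintype.card α = j → n + 1 = j + k →
      Nat.card {p : α → Fin n // IsParkingCount p} = forestCount j k)
    {α : Type} [Fintype α] (hα : Fintype.card α = m + 1) (A : Finset α) :
    Nat.card {p : α → Fin (m + r) // IsParkingCount p ∧ highCars m p = A} =
      r ^ A.card * forestCount (m + 1 - A.card) A.card := by
  rw [card_isParkingCount_fiber r hα]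
  congr 1
  have hc : Fintype.card {a // a ∉ A} = m + 1 - A.card := by
    rw [Fintype.card_subtype_compl, hα, Fintype.card_coe]
  have hle : A.card ≤ m + 1 := hα ▸ Finset.card_le_univ A
  -- If A is empty, m + 1 cars would have to park in m spots, so both sides are 0.
  rcases A.eq_empty_or_nonempty with rfl | hA
  · have : IsEmpty {q : {a : α // a ∉ (∅ : Finset α)} → Fin m // IsParkingCount q} :=
      ⟨fun q => by
        have := q.2.card_le
        rw [hc, Finset.card_empty] at this
        omega⟩
    simp [forestCount]
  · have := hA.card_pos
    exact ih (m + 1 - A.card) (by omega) _ _ _ hc (by omega)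

theorem card_isParkingCount (m : ℕ) : ∀ (α : Type) [Fintype α] (n r : ℕ), Fintype.card α = m →
    n + 1 = m + r → Nat.card {p : α → Fin n // IsParkingCount p} = forestCount m r := by
  induction m using Nat.strong_induction_on with
  | _ m ih =>
    intro α _ n r hα hn
    rcases m with _ | m
    · have : IsEmpty α := Fintype.card_eq_zero_iff.1 hα
      have : Unique {p : α → Fin n // IsParkingCount p} :=
        ⟨⟨⟨isEmptyElim, fun v => by simp⟩⟩, fun f => Subtype.ext (Subsingleton.elim _ _)⟩
      simp [forestCount]
    · obtain rfl : n = m + r := by omega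
      exact card_of_fiber hα (card_isParkingCount_fiber_eq_forestCount
        (fun j hj => ih j (Nat.lt_succ_of_le hj)) hα)

theorem sum_pow_card_highCars {R α : Type} [CommSemiring R] [Fintype α]
    {m : ℕ} (r : ℕ) (hα : Fintype.card α = m + 1) (z : R) :
    ∑ p : α → Fin (m + r) with IsParkingCount p, z ^ (highCars m p).card =
      r * z * (r * z + (m + 1)) ^ m :=
  sum_pow_card_of_fiber hα
    (card_isParkingCount_fiber_eq_forestCount (fun j _ => card_isParkingCount j) hα) z

theorem isParkingFunction_iff_isParkingCount {m n : ℕ} (hmn : m ≤ n) (π : Fin m → Fin n) :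
    IsParkingFunction π ↔ IsParkingCount fun i => (π i).rev := by
  rw [isParkingFunction_iff]
  have key : ∀ v ≤ n, (Finset.univ.filter fun i => n - v ≤ (π i : ℕ)) =
      Finset.univ.filter fun i => ((π i).rev : ℕ) < v := by
    intro v hv
    ext i
    have := (π i).2
    simp only [Finset.mem_filter, Finset.mem_univ, true_and, Fin.val_rev]
    omega
  constructor
  · intro h v
    rcases le_total v n with hv | hv
    · have := h (n - v) (Nat.sub_le _ _)
      rw [Nat.sub_sub_self hv] at this
      convert this using 2
      exact (key v hv).symm
    · exact (Finset.card_le_univ _).trans (by simpa using hmn.trans hv)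
  · intro h v hv
    have := h (n - v)
    rw [← key _ (Nat.sub_le _ _)] at this
    rwa [Nat.sub_sub_self hv] at this

/-- With m + 1 cars and m + r spots the level set is the first r spots, which reversal sends to the
values from m on. The bound r ≥ 1 keeps the truncated subtraction in `slev` exact. -/
theorem slev_eq_card_highCars {m r : ℕ} (π : Fin (m + 1) → Fin (m + r)) (hr : 1 ≤ r) :
    slev π = (highCars m fun i => (π i).rev).card := by
  rw [slev, highCars]
  congr 1
  ext i
  have := (π i).2
  simp only [Finset.mem_filter, Finset.mem_univ, true_and, Fin.val_rev]
  omega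

theorem sum_pow_slev {R : Type} [CommSemiring R] {m n : ℕ} (hm : m ≠ 0) (hmn : m ≤ n) (z : R) :
    ∑ π ∈ (PF m n).toFinite.toFinset, z ^ slev π =
      (n - m + 1 : ℕ) * z * ((n - m + 1 : ℕ) * z + m) ^ (m - 1) := by
  obtain ⟨m, rfl⟩ := Nat.exists_eq_add_one_of_ne_zero hm
  rw [Nat.add_sub_cancel, Nat.cast_add_one m]
  obtain ⟨k, rfl⟩ := Nat.exists_eq_add_of_le hmn
  obtain ⟨r, hr, h⟩ : ∃ r, 1 ≤ r ∧ m + 1 + k = m + r := ⟨k + 1, by omega, by omega⟩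
  rw [h, show m + r - (m + 1) + 1 = r by omega,
    ← sum_pow_card_highCars (α := Fin (m + 1)) r (Fintype.card_fin _)]
  refine Finset.sum_equiv (Equiv.arrowCongr (Equiv.refl _) Fin.revPerm) (fun π => ?_) fun π _ => ?_
  · simp only [PF, Set.Finite.mem_toFinset, Set.mem_ofPred_eq, Finset.mem_filter, Finset.mem_univ,
      true_and]
    exact isParkingFunction_iff_isParkingCount (by omega) π
  · rw [slev_eq_card_highCars π hr]
    rfl

end

/-! ### Central limit theorem -/

section

open Complex Topology

/-- Convergence of N g forces g → 0, and N log(1 + g) differs from N g by at most |N g| |g|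
eventually, which tends to 0. -/
theorem tendsto_one_add_pow_exp_of_tendsto_mul {N : ℕ → ℕ} {g : ℕ → ℂ} {t : ℂ}
    (hN : Tendsto N atTop atTop) (h : Tendsto (fun k => (N k : ℂ) * g k) atTop (𝓝 t)) :
    Tendsto (fun k => (1 + g k) ^ N k) atTop (𝓝 (exp t)) := by
  have hNinv : Tendsto (fun k => ((N k : ℂ))⁻¹) atTop (𝓝 0) :=
    (tendsto_inv_atTop_nhds_zero_nat (𝕜 := ℂ)).comp hN
  have hN0 : ∀ᶠ k in atTop, N k ≠ 0 := hN.eventually_ne_atTop 0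
  have hg : Tendsto g atTop (𝓝 0) := by
    have := hNinv.mul h
    rw [zero_mul] at this
    refine this.congr' ?_
    filter_upwards [hN0] with k hk
    have : (N k : ℂ) ≠ 0 := Nat.cast_ne_zero.2 hk
    field_simp
  have hgn : Tendsto (fun k => ‖g k‖) atTop (𝓝 0) := tendsto_zero_iff_norm_tendsto_zero.1 hg
  have hsmall : ∀ᶠ k in atTop, ‖g k‖ < 1 / 2 := hgn.eventually_lt_const (by norm_num)
  have hrem : Tendsto (fun k => (N k : ℂ) * (log (1 + g k) - g k)) atTop (𝓝 0) := by
    have hb : Tendsto (fun k => ‖(N k : ℂ) * g k‖ * ‖g k‖) atTop (𝓝 0) := by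
      simpa using h.norm.mul hgn
    refine squeeze_zero_norm' ?_ hb
    filter_upwards [hsmall] with k hk
    have h1 := norm_log_one_add_sub_self_le (hk.trans (by norm_num))
    have h2 : (1 - ‖g k‖)⁻¹ ≤ 2 := by
      rw [inv_le_comm₀ (by linarith) (by norm_num)]
      linarith
    have h3 : ‖log (1 + g k) - g k‖ ≤ ‖g k‖ ^ 2 := by
      refine h1.trans ?_
      have := mul_le_mul_of_nonneg_left h2 (sq_nonneg ‖g k‖)
      linarith
    rw [norm_mul, norm_mul, mul_assoc]
    exact mul_le_mul_of_nonneg_left (by rwa [← sq]) (norm_nonneg _)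
  have hsum := (continuous_exp.tendsto _).comp (h.add hrem)
  rw [add_zero] at hsum
  refine hsum.congr' ?_
  filter_upwards [hsmall] with k hk
  have hne : 1 + g k ≠ 0 := fun h0 => by
    have : g k = -1 := by linear_combination h0
    rw [this] at hk
    norm_num at hk
  simp only [Function.comp_apply]
  rw [← mul_add, add_sub_cancel, exp_nat_mul, exp_log hne]

theorem norm_exp_ofReal_mul_I_sub_le {y : ℝ} (hy : |y| ≤ 1) :
    ‖exp (y * I) - (1 + y * I - y ^ 2 / 2)‖ ≤ 3 * |y| ^ 3 := by
  have h := norm_exp_sub_sum_le_norm_mul_exp (y * I) 3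
  have hn : ‖(y * I : ℂ)‖ = |y| := by simp
  have hs : ∑ j ∈ Finset.range 3, (y * I : ℂ) ^ j / j.factorial = 1 + y * I - y ^ 2 / 2 := by
    simp [Finset.sum_range_succ, Nat.factorial, mul_pow]
    ring
  rw [hs, hn] at h
  refine h.trans ?_
  rw [mul_comm]
  refine mul_le_mul_of_nonneg_right ?_ (by positivity)
  -- The constant 3 is an upper bound for e.
  exact (Real.exp_le_exp.2 hy).trans (Real.exp_one_lt_d9.le.trans (by norm_num))

/-- Second-order expansion at both atoms: centering cancels the linear terms, the quadratic ones
give the variance p(1 - p), and the error is a convex combination of two cubic errors, hence uniform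
in p. -/
theorem norm_centered_bernoulli_charFun_sub_le {p s : ℝ} (hp0 : 0 ≤ p) (hp1 : p ≤ 1)
    (hs : |s| ≤ 1) :
    ‖((1 - p) * exp ((-(s * p) : ℝ) * I) + p * exp ((s * (1 - p) : ℝ) * I) - 1 : ℂ) +
      ((s ^ 2 * (p * (1 - p)) / 2 : ℝ) : ℂ)‖ ≤ 3 * |s| ^ 3 := by
  have ha : |-(s * p)| ≤ |s| := by
    rw [abs_neg, abs_mul, abs_of_nonneg hp0]
    exact mul_le_of_le_one_right (abs_nonneg _) hp1
  have hb : |s * (1 - p)| ≤ |s| := by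
    rw [abs_mul, abs_of_nonneg (sub_nonneg.2 hp1)]
    exact mul_le_of_le_one_right (abs_nonneg _) (by linarith)
  have h1 := norm_exp_ofReal_mul_I_sub_le (ha.trans hs)
  have h2 := norm_exp_ofReal_mul_I_sub_le (hb.trans hs)
  have h1' := h1.trans (mul_le_mul_of_nonneg_left
    (pow_le_pow_left₀ (abs_nonneg _) ha 3) (by norm_num : (0 : ℝ) ≤ 3))
  have h2' := h2.trans (mul_le_mul_of_nonneg_left
    (pow_le_pow_left₀ (abs_nonneg _) hb 3) (by norm_num : (0 : ℝ) ≤ 3))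
  have hsplit : ((1 - p) * exp ((-(s * p) : ℝ) * I) + p * exp ((s * (1 - p) : ℝ) * I) - 1 : ℂ) +
      ((s ^ 2 * (p * (1 - p)) / 2 : ℝ) : ℂ) =
      ((1 - p : ℝ) : ℂ) * (exp ((-(s * p) : ℝ) * I) -
        (1 + (-(s * p) : ℝ) * I - (-(s * p) : ℝ) ^ 2 / 2)) +
      (p : ℂ) * (exp ((s * (1 - p) : ℝ) * I) -
        (1 + (s * (1 - p) : ℝ) * I - (s * (1 - p) : ℝ) ^ 2 / 2)) := by
    push_cast
    ring
  rw [hsplit]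
  refine (norm_add_le _ _).trans ?_
  rw [norm_mul, norm_mul, norm_real, norm_real, Real.norm_of_nonneg hp0,
    Real.norm_of_nonneg (sub_nonneg.2 hp1)]
  nlinarith [mul_le_mul_of_nonneg_left h1' (sub_nonneg.2 hp1), mul_le_mul_of_nonneg_left h2' hp0]

/-- Characteristic functions of centered binomial variables in a triangular array. -/
theorem tendsto_centered_binomial_charFun {N : ℕ → ℕ} {p s : ℕ → ℝ} {τ : ℝ}
    (hN : Tendsto N atTop atTop) (hp0 : ∀ k, 0 ≤ p k) (hp1 : ∀ k, p k ≤ 1)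
    (hs : Tendsto s atTop (𝓝 0))
    (h2 : Tendsto (fun k => N k * (s k ^ 2 * (p k * (1 - p k)))) atTop (𝓝 τ))
    (h3 : Tendsto (fun k => N k * |s k| ^ 3) atTop (𝓝 0)) :
    Tendsto (fun k => ((1 - p k) * exp ((-(s k * p k) : ℝ) * I) +
      p k * exp ((s k * (1 - p k) : ℝ) * I) : ℂ) ^ N k) atTop (𝓝 (exp (-(τ / 2 : ℝ)))) := by
  set g : ℕ → ℂ := fun k => (1 - p k) * exp ((-(s k * p k) : ℝ) * I) +
      p k * exp ((s k * (1 - p k) : ℝ) * I) - 1 with hgdef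
  have hsmall : ∀ᶠ k in atTop, |s k| ≤ 1 := by
    have := hs.abs
    rw [abs_zero] at this
    exact (this.eventually_lt_const zero_lt_one).mono fun k hk => hk.le
  have hrem : Tendsto (fun k => (N k : ℂ) *
      (g k + ((s k ^ 2 * (p k * (1 - p k)) / 2 : ℝ) : ℂ))) atTop (𝓝 0) := by
    have h3' := h3.const_mul 3
    rw [mul_zero] at h3'
    refine squeeze_zero_norm' ?_ h3'
    filter_upwards [hsmall] with k hk
    rw [norm_mul, norm_natCast, mul_left_comm 3]
    exact mul_le_mul_of_nonneg_left
      (norm_centered_bernoulli_charFun_sub_le (hp0 k) (hp1 k) hk) (Nat.cast_nonneg (N k))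
  have hg : Tendsto (fun k => (N k : ℂ) * g k) atTop (𝓝 (-(τ / 2 : ℝ))) := by
    have hτ : Tendsto (fun k => ((N k * (s k ^ 2 * (p k * (1 - p k))) / 2 : ℝ) : ℂ)) atTop
        (𝓝 ((τ / 2 : ℝ) : ℂ)) := (continuous_ofReal.tendsto _).comp (h2.div_const 2)
    have := hrem.sub hτ
    rw [zero_sub] at this
    refine this.congr fun k => ?_
    push_cast
    ring
  refine (tendsto_one_add_pow_exp_of_tendsto_mul hN hg).congr fun k => ?_
  rw [hgdef, add_sub_cancel]

/-! ### From the generating function to the limit law -/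

theorem integral_uniformOn_eq_sum {Ω : Type*} [Finite Ω] [MeasurableSpace Ω]
    [DiscreteMeasurableSpace Ω] (s : Set Ω) (f : Ω → ℂ) :
    ∫ x, f x ∂(uniformOn s) =
      ((s.toFinite.toFinset.card : ℂ))⁻¹ * ∑ x ∈ s.toFinite.toFinset, f x := by
  have hs : s = (s.toFinite.toFinset : Set Ω) := by simp
  have hc : Measure.count s = (s.toFinite.toFinset.card : ENNReal) :=
    Measure.count_apply_finite s s.toFinite
  rw [uniformOn, ProbabilityTheory.cond, integral_smul_measure, hc]
  conv_lhs => rw [hs]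
  rw [setIntegral_finset (hf := Integrable.of_finite.integrableOn)]
  simp [Measure.real]

/-- This is the statement X = 1 + Bin(m - 1, p) in law, in terms of characteristic functions. The
binomial is centered at its true mean, and the discrepancy between the mean of X and μ is isolated
in a phase factor. -/
theorem integral_exp_uniformOn {Ω : Type*} [Finite Ω] [MeasurableSpace Ω]
    [DiscreteMeasurableSpace Ω] {A : Set Ω} {X : Ω → ℕ} {r m : ℕ} (hr : r ≠ 0) (hm : m ≠ 0)
    (h : ∀ z : ℂ, ∑ x ∈ A.toFinite.toFinset, z ^ X x = r * z * (r * z + m) ^ (m - 1))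
    {p : ℝ} (hp : p = r / (r + m)) (s μ : ℝ) :
    ∫ x, exp ((s * (X x - μ) : ℝ) * I) ∂(uniformOn A) =
      exp ((s * (1 + (m - 1 : ℕ) * p - μ) : ℝ) * I) *
        ((1 - p) * exp ((-(s * p) : ℝ) * I) + p * exp ((s * (1 - p) : ℝ) * I)) ^ (m - 1) := by
  -- The normalizing constant is the generating function at z = 1.
  have hcard : (A.toFinite.toFinset.card : ℂ) = r * (r + m) ^ (m - 1) := by simpa using h 1
  have hr' : (r : ℂ) ≠ 0 := Nat.cast_ne_zero.2 hr
  have hrm : (r + m : ℂ) ≠ 0 := by exact_mod_cast (by omega : r + m ≠ 0)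
  have hterm : ∀ x, exp ((s * (X x - μ) : ℝ) * I) = exp ((-(s * μ) : ℝ) * I) *
      exp (s * I) ^ X x := by
    intro x
    rw [← exp_nat_mul, ← exp_add]
    congr 1
    push_cast
    ring
  simp_rw [integral_uniformOn_eq_sum, hterm]
  rw [← Finset.mul_sum, h, hcard]
  have e1 : ((1 - p) * exp ((-(s * p) : ℝ) * I) + p * exp ((s * (1 - p) : ℝ) * I) : ℂ) =
      exp ((-(s * p) : ℝ) * I) * ((r * exp (s * I) + m) / (r + m)) := by
    have : exp ((s * (1 - p) : ℝ) * I) = exp ((-(s * p) : ℝ) * I) * exp (s * I) := by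
      rw [← exp_add]
      congr 1
      push_cast
      ring
    have hpc : (p : ℂ) = r / (r + m) := by rw [hp]; push_cast; rfl
    rw [this, hpc]
    field_simp
    ring
  have e2 : exp ((s * (1 + (m - 1 : ℕ) * p - μ) : ℝ) * I) * exp ((-(s * p) : ℝ) * I) ^ (m - 1) =
      exp ((-(s * μ) : ℝ) * I) * exp (s * I) := by
    rw [← exp_nat_mul, ← exp_add, ← exp_add]
    congr 1
    push_cast
    ring
  rw [e1, mul_pow, ← mul_assoc (exp _) (exp _ ^ _), e2, div_pow]
  field_simp

theorem tendstoInDistribution_of_sum_pow {Ω : ℕ → Type} [∀ k, Finite (Ω k)]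
    [∀ k, MeasurableSpace (Ω k)] [∀ k, DiscreteMeasurableSpace (Ω k)] (A : ∀ k, Set (Ω k))
    [∀ k, IsProbabilityMeasure (uniformOn (A k))] (X : ∀ k, Ω k → ℕ)
    {c : ℝ} (hc0 : 0 < c) (hc1 : c < 1) {m n : ℕ → ℕ}
    (hmn : ∀ k, m k ≤ n k) (hn : Tendsto n atTop atTop)
    (hm : ∃ C : ℝ, ∀ k, |(m k : ℝ) - c * (n k : ℝ)| ≤ C)
    (h : ∀ k, m k ≠ 0 → ∀ z : ℂ, ∑ x ∈ (A k).toFinite.toFinset, z ^ X k x =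
      (n k - m k + 1 : ℕ) * z * ((n k - m k + 1 : ℕ) * z + m k) ^ (m k - 1)) :
    TendstoInDistribution
      (fun k x => ((X k x : ℝ) - c * (1 - c) * (n k : ℝ)) / √(c ^ 2 * (1 - c) * (n k : ℝ)))
      atTop (id : ℝ → ℝ) (fun k => uniformOn (A k)) (gaussianReal 0 1) := by
  obtain ⟨C, hC⟩ := hm
  have hc1' : 0 < 1 - c := sub_pos.2 hc1
  have hσ : 0 < c ^ 2 * (1 - c) := by positivity
  have hnR : Tendsto (fun k => (n k : ℝ)) atTop atTop := tendsto_natCast_atTop_atTop.comp hn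
  have hn0 : ∀ᶠ k in atTop, (0 : ℝ) < n k := hnR.eventually_gt_atTop 0
  have hninv : Tendsto (fun k => ((n k : ℝ))⁻¹) atTop (𝓝 0) := tendsto_inv_atTop_zero.comp hnR
  have herr : Tendsto (fun k => ((m k : ℝ) - c * n k) * (n k : ℝ)⁻¹) atTop (𝓝 0) :=
    bdd_le_mul_tendsto_zero' C (Eventually.of_forall hC) hninv
  have hmdiv : Tendsto (fun k => (m k : ℝ) * (n k : ℝ)⁻¹) atTop (𝓝 c) := by
    have := herr.add_const c
    rw [zero_add] at this
    refine this.congr' ?_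
    filter_upwards [hn0] with k hk
    field_simp
    ring
  have hmtop : Tendsto (fun k => (m k : ℝ)) atTop atTop := by
    refine tendsto_atTop_mono (fun k => ?_) (tendsto_atTop_add_const_right _ (-C)
      (hnR.const_mul_atTop hc0))
    have := (abs_le.1 (hC k)).1
    linarith
  have hmtop' : Tendsto m atTop atTop := tendsto_natCast_atTop_iff.1 hmtop
  -- The generating function formula is available only for m k ≠ 0, which suffices in the limit.
  have hm0 : ∀ᶠ k in atTop, m k ≠ 0 := hmtop'.eventually_ne_atTop 0
  have hN : Tendsto (fun k => m k - 1) atTop atTop := (tendsto_sub_atTop_nat 1).comp hmtop'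
  set p : ℕ → ℝ := fun k => (n k - m k + 1 : ℕ) / ((n k - m k + 1 : ℕ) + m k) with hp
  have hrm : ∀ k, ((n k - m k + 1 : ℕ) : ℝ) + m k = n k + 1 := fun k => by
    rw [← Nat.cast_add, show n k - m k + 1 + m k = n k + 1 by have := hmn k; omega]
    push_cast
    rfl
  have hp' : ∀ k, p k = (n k + 1 - m k) / (n k + 1) := fun k => by
    simp only [hp]
    rw [hrm, ← hrm k]
    ring
  have hp0 : ∀ k, 0 ≤ p k := fun k => by positivity
  have hp1 : ∀ k, p k ≤ 1 := fun k => by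
    rw [hp', div_le_one (by positivity)]
    have : (0 : ℝ) ≤ m k := Nat.cast_nonneg _
    linarith
  have hplim : Tendsto p atTop (𝓝 (1 - c)) := by
    have h1 : Tendsto (fun k => (1 + (n k : ℝ)⁻¹ - m k * (n k : ℝ)⁻¹) / (1 + (n k : ℝ)⁻¹)) atTop
        (𝓝 ((1 + 0 - c) / (1 + 0))) :=
      ((hninv.const_add 1).sub hmdiv).div (hninv.const_add 1) (by norm_num)
    rw [add_zero, div_one] at h1
    refine h1.congr' ?_
    filter_upwards [hn0] with k hk
    rw [hp']
    field_simp
  have hNdiv : Tendsto (fun k => ((m k - 1 : ℕ) : ℝ) * (n k : ℝ)⁻¹) atTop (𝓝 c) := by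
    have := hmdiv.sub hninv
    rw [sub_zero] at this
    refine this.congr' ?_
    filter_upwards [hm0] with k hk
    rw [Nat.cast_pred (Nat.pos_of_ne_zero hk)]
    ring
  refine ⟨fun k => (Measurable.of_discrete).aemeasurable, by fun_prop, ?_⟩
  refine ProbabilityMeasure.tendsto_iff_tendsto_charFun.2 fun t => ?_
  set s : ℕ → ℝ := fun k => t / √(c ^ 2 * (1 - c) * n k) with hsdef
  have hs : Tendsto s atTop (𝓝 0) := Tendsto.const_div_atTop
    (Real.tendsto_sqrt_atTop.comp (hnR.const_mul_atTop hσ)) t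
  have hs2 : ∀ k, s k ^ 2 = t ^ 2 / (c ^ 2 * (1 - c)) * (n k : ℝ)⁻¹ := fun k => by
    simp only [hsdef]
    rw [div_pow, Real.sq_sqrt (by positivity), ← div_div, div_eq_mul_inv _ (n k : ℝ)]
  -- The variance (m - 1) p (1 - p) is asymptotic to cn · (1 - c) · c, exactly the square of the
  -- normalization.
  have h2 : Tendsto (fun k => ((m k - 1 : ℕ) : ℝ) * (s k ^ 2 * (p k * (1 - p k)))) atTop
      (𝓝 (t ^ 2)) := by
    have := (hNdiv.mul (hplim.mul (hplim.const_sub 1))).const_mul (t ^ 2 / (c ^ 2 * (1 - c)))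
    have hlim : t ^ 2 / (c ^ 2 * (1 - c)) * (c * ((1 - c) * (1 - (1 - c)))) = t ^ 2 := by
      have := hc0.ne'
      have := hc1'.ne'
      field_simp
      ring
    rw [hlim] at this
    refine this.congr fun k => ?_
    rw [hs2]
    ring
  have h3 : Tendsto (fun k => ((m k - 1 : ℕ) : ℝ) * |s k| ^ 3) atTop (𝓝 0) := by
    have hsa : Tendsto (fun k => |s k|) atTop (𝓝 0) := by simpa using hs.abs
    have := (hNdiv.const_mul (t ^ 2 / (c ^ 2 * (1 - c)))).mul hsa
    rw [mul_zero] at this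
    refine this.congr fun k => ?_
    rw [pow_succ |s k|, sq_abs, hs2]
    ring
  -- The true mean differs from c(1 - c)n by a bounded amount, which s k → 0 makes negligible. This
  -- is where m = cn + O(1) is needed; m ~ cn alone would not be enough.
  have hd : Tendsto (fun k => exp ((s k * (1 + ((m k - 1 : ℕ) : ℝ) * p k - c * (1 - c) * n k) : ℝ)
      * I)) atTop (𝓝 1) := by
    have hbd : ∀ᶠ k in atTop,
        |1 + ((m k - 1 : ℕ) : ℝ) * p k - c * (1 - c) * n k| ≤ 1 + (C + 1) + (1 + C) := by
      filter_upwards [hm0] with k hk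
      rw [hp', Nat.cast_pred (Nat.pos_of_ne_zero hk)]
      set e := (m k : ℝ) - c * n k with he
      have heC : |e| ≤ C := hC k
      have hn1 : (0 : ℝ) < n k + 1 := by positivity
      have hm1 : (1 : ℝ) ≤ m k := by exact_mod_cast Nat.one_le_iff_ne_zero.2 hk
      have hmn' : (m k : ℝ) ≤ n k := by exact_mod_cast hmn k
      have hq0 : 0 ≤ ((m k : ℝ) - 1) / (n k + 1) := div_nonneg (by linarith) hn1.le
      have hq1 : ((m k : ℝ) - 1) / (n k + 1) ≤ 1 := by
        rw [div_le_one hn1]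
        linarith
      -- Substitute m = cn + e, so that p = 1 - c + (c - e)/(n + 1); the terms of order n cancel.
      have hsplit : 1 + ((m k : ℝ) - 1) * ((n k + 1 - m k) / (n k + 1)) - c * (1 - c) * n k =
          1 + (1 - c) * (e - 1) + ((m k : ℝ) - 1) / (n k + 1) * (c - e) := by
        rw [he]
        field_simp
        ring
      have ha : |(1 - c) * (e - 1)| ≤ C + 1 := by
        rw [abs_mul, abs_of_pos hc1']
        have h1 : |e - 1| ≤ C + 1 := (abs_sub _ _).trans (by rw [abs_one]; linarith)
        have := abs_nonneg (e - 1)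
        nlinarith
      have hb : |((m k : ℝ) - 1) / (n k + 1) * (c - e)| ≤ 1 + C := by
        rw [abs_mul, abs_of_nonneg hq0]
        have h1 : |c - e| ≤ 1 + C := (abs_sub _ _).trans (by rw [abs_of_pos hc0]; linarith)
        have := abs_nonneg (c - e)
        nlinarith
      rw [hsplit]
      refine (abs_add_le _ _).trans (add_le_add ((abs_add_le _ _).trans ?_) hb)
      rw [abs_one]
      linarith
    have h0 := bdd_le_mul_tendsto_zero' _ hbd hs
    have h1 : Tendsto (fun y : ℝ => exp ((y : ℂ) * I)) (𝓝 0) (𝓝 1) := by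
      have : Continuous fun y : ℝ => exp ((y : ℂ) * I) := by fun_prop
      simpa using this.tendsto 0
    refine (h1.comp h0).congr fun k => ?_
    simp only [Function.comp_apply, mul_comm (s k)]
  have hlim := hd.mul (tendsto_centered_binomial_charFun hN hp0 hp1 hs h2 h3)
  have hgauss : charFun ((gaussianReal 0 1).map id) t = exp (-(t ^ 2 / 2 : ℝ)) := by
    rw [Measure.map_id, charFun_gaussianReal]
    congr 1
    push_cast
    ring
  rw [one_mul] at hlim
  simp only [ProbabilityMeasure.coe_mk]
  rw [hgauss]
  refine hlim.congr' ?_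
  filter_upwards [hm0] with k hk
  rw [← integral_exp_uniformOn (Nat.succ_ne_zero _) hk (h k hk) rfl (s k) (c * (1 - c) * n k),
    charFun_apply_real, integral_map Measurable.of_discrete.aemeasurable (by fun_prop)]
  refine integral_congr_ae (Eventually.of_forall fun x => ?_)
  simp only [hsdef]
  congr 1
  push_cast
  ring

end

theorem proposition5p3 (c : ℝ) (hc0 : 0 < c) (hc1 : c < 1) (m n : ℕ → ℕ)
    (hmn : ∀ k, m k ≤ n k) (hn : Tendsto n atTop atTop)
    (hm : ∃ C : ℝ, ∀ k, |(m k : ℝ) - c * (n k : ℝ)| ≤ C) :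
    (haveI : ∀ k, IsProbabilityMeasure (uniformOn (PF (m k) (n k))) :=
        fun k => isProbabilityMeasure_uniformOn_PF (hmn k);
      TendstoInDistribution
        (fun k (π : Fin (m k) → Fin (n k)) =>
          ((slev π : ℝ) - c * (1 - c) * (n k : ℝ)) / √(c ^ 2 * (1 - c) * (n k : ℝ)))
        atTop (id : ℝ → ℝ) (fun k => uniformOn (PF (m k) (n k))) (gaussianReal 0 1)) ∧
    TendstoInDistribution
      (fun k (f : Fin (m k) → Fin (n k - m k + 1) ⊕ Fin (m k)) =>
        ((rootDeg f : ℝ) - c * (1 - c) * (n k : ℝ)) / √(c ^ 2 * (1 - c) * (n k : ℝ)))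
      atTop (id : ℝ → ℝ) (fun k => uniformOn (RootedForests (m k) (n k))) (gaussianReal 0 1) := by
  have : ∀ k, IsProbabilityMeasure (uniformOn (PF (m k) (n k))) :=
    fun k => isProbabilityMeasure_uniformOn_PF (hmn k)
  exact ⟨tendstoInDistribution_of_sum_pow (fun k => PF (m k) (n k)) (fun _ => slev)
      hc0 hc1 hmn hn hm fun k hk z => sum_pow_slev hk (hmn k) z,
    tendstoInDistribution_of_sum_pow (fun k => RootedForests (m k) (n k)) (fun _ => rootDeg)
      hc0 hc1 hmn hn hm fun k hk z => sum_pow_rootDeg hk z⟩
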